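/- Let $\mathbf{K}$ be a commutative ring, let $u_0,u_1\in\mathbf{K}^\times$ and let $n\ge 0$. Let $B_{n+1}$ be the braid group on $n+1$ strands, presented by the Artin generators $\sigma_1,\dots,\sigma_n$ with relations $\sigma_i\sigma_{i+1}\sigma_i=\sigma_{i+1}\sigma_i\sigma_{i+1}$ and $\sigma_i\sigma_j=\sigma_j\sigma_i$ for $|i-j|\ge 2$. The Hecke algebra $H$ of type $A_n$ with parameters $u_0,u_1$ is the quotient of the group algebra $\mathbf{K}B_{n+1}$ by the relations $(\sigma-u_0)(\sigma-u_1)=0$ for every braided reflection $\sigma$, that is, for every conjugate $\sigma$ of an Artin generator. Let $$\Delta=(\sigma_1\sigma_2\cdots\sigma_n)(\sigma_1\cdots\sigma_{n-1})\cdots(\sigma_1\sigma_2)\,\sigma_1\in B_{n+1}$$ be Garside's fundamental element. Then the image of $\Delta$ in $H$ is annihilated by the polynomial $$\prod_{\substack{i,j\ge 0\\ i+j=n(n+1)}}\bigl(X^2-(-1)^i u_0^i u_1^j\bigr)\in\mathbf{K}[X].$$ -/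

import Mathlib

namespace TypeA

/-- Artin's relations on generators `σ_0, …, σ_{n-1}`:
`σ_i σ_{i+1} σ_i = σ_{i+1} σ_i σ_{i+1}`, and `σ_i σ_j = σ_j σ_i` when `|i - j| ≥ 2`. -/
def artinRelations (n : ℕ) : Set (FreeGroup (Fin n)) :=
  {r | ∃ i j : Fin n, i.val + 1 = j.val ∧
      r = FreeGroup.of i * FreeGroup.of j * FreeGroup.of i *
        (FreeGroup.of j * FreeGroup.of i * FreeGroup.of j)⁻¹} ∪
  {r | ∃ i j : Fin n, i.val + 1 < j.val ∧
      r = FreeGroup.of i * FreeGroup.of j * (FreeGroup.of j * FreeGroup.of i)⁻¹}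

/-- The braid group of type `A_n`, that is, the braid group on `n + 1` strands. -/
abbrev BraidGroup (n : ℕ) : Type := PresentedGroup (artinRelations n)

/-- The Artin generator `σ_i` of the braid group on `n + 1` strands. -/
def artinGen {n : ℕ} (i : Fin n) : BraidGroup n := PresentedGroup.of i

/-- The braided reflections in type `A_n` are the conjugates of the Artin generators. -/
def IsBraidedReflection {n : ℕ} (b : BraidGroup n) : Prop :=
  ∃ i : Fin n, IsConj (artinGen i) b

/-- The product `σ_0 σ_1 ⋯ σ_t`. -/
def initialProduct {n : ℕ} (t : Fin n) : BraidGroup n :=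
  (List.ofFn fun s : Fin (t.val + 1) => artinGen (Fin.castLE t.isLt s)).prod

/-- Garside's fundamental element
`Δ = (σ_0 σ_1 ⋯ σ_{n-1}) (σ_0 σ_1 ⋯ σ_{n-2}) ⋯ (σ_0 σ_1) σ_0` of the braid group on `n + 1`
strands. -/
def garside (n : ℕ) : BraidGroup n :=
  (List.ofFn fun t : Fin n => initialProduct t.rev).prod

/-- The Hecke relations `(σ - u₀) (σ - u₁) = 0` in the group algebra of the braid group, one for
every braided reflection `σ`. -/
inductive HeckeRel {K : Type*} [CommRing K] (n : ℕ) (u₀ u₁ : Kˣ) :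
    MonoidAlgebra K (BraidGroup n) → MonoidAlgebra K (BraidGroup n) → Prop
  | quadratic (b : BraidGroup n) (hb : IsBraidedReflection b) :
      HeckeRel n u₀ u₁
        ((MonoidAlgebra.of K (BraidGroup n) b - algebraMap K _ (u₀ : K)) *
          (MonoidAlgebra.of K (BraidGroup n) b - algebraMap K _ (u₁ : K))) 0

/-- The Hecke algebra of type `A_n` over `K` with parameters `u₀, u₁`: the quotient of the group
algebra of the braid group by the Hecke relations. -/
abbrev HeckeAlgebra {K : Type*} [CommRing K] (n : ℕ) (u₀ u₁ : Kˣ) : Type _ :=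
  RingQuot (HeckeRel n u₀ u₁)

/-- The natural map from the braid group to the Hecke algebra. -/
noncomputable def toHecke {K : Type*} [CommRing K] {n : ℕ} (u₀ u₁ : Kˣ) (b : BraidGroup n) :
    HeckeAlgebra n u₀ u₁ :=
  RingQuot.mkAlgHom K (HeckeRel n u₀ u₁) (MonoidAlgebra.of K (BraidGroup n) b)

end TypeA

/-! Write `T_i` for the image of `σ_i` and `L_k = T_{k-1} ⋯ T_0 T_0 ⋯ T_{k-1}` for the Jucys–Murphy
elements. They commute, and `Δ² = L_1 ⋯ L_n` (`fundamental_succ_sq`). On a joint eigenvector `L_k`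
has value `u₀^a (-u₁)^b` with `a + b = 2k` (`exists_jucysMurphy_eigenvalue`), so `Δ²` has such a
value with `a + b = n(n+1)`. This degree is even, hence `(-u₁)^b = (-1)^a u₁^b`, and the polynomial
kills every joint eigenvector.

Over a general `K` joint eigenvectors need not span, so the identity is moved to `ℝ`. For units with
`αβ = -u₀u₁`, the Hecke algebra acts faithfully on the free module on permutations
(`heckeModel_injective`). With `α = 1` the claim says that a matrix of integer polynomials in `u₀,
u₁` vanishes, and it suffices to test real `u₀ > 0 > u₁`. There `α = β = √(-u₀u₁)` makes the
generators symmetric, and the spectral theorem supplies a spanning set of joint eigenvectors. -/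

namespace TypeA

/-! ### Braid combinatorics in a monoid -/

/-- A sequence in a monoid whose first `n` terms satisfy Artin's relations. -/
structure IsBraidSystem {G : Type*} [Monoid G] (s : ℕ → G) (n : ℕ) : Prop where
  braid : ∀ i, i + 1 < n → s i * s (i + 1) * s i = s (i + 1) * s i * s (i + 1)
  comm : ∀ i j, i + 2 ≤ j → j < n → Commute (s i) (s j)

/-- The ascending product `s 0 * s 1 * ⋯ * s (k - 1)`. -/
def ascProd {G : Type*} [Monoid G] (s : ℕ → G) : ℕ → G
  | 0 => 1
  | k + 1 => ascProd s k * s k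

/-- The descending product `s (j + m - 1) * ⋯ * s (j + 1) * s j`. -/
def descProd {G : Type*} [Monoid G] (s : ℕ → G) (j : ℕ) : ℕ → G
  | 0 => 1
  | m + 1 => s (j + m) * descProd s j m

/-- The fundamental element built from the first `k` terms of `s`. -/
def fundamental {G : Type*} [Monoid G] (s : ℕ → G) : ℕ → G
  | 0 => 1
  | k + 1 => ascProd s (k + 1) * fundamental s k

/-- The multiplicative Jucys–Murphy elements `s (k - 1) * ⋯ * s 0 * s 0 * ⋯ * s (k - 1)`. -/
def jucysMurphy {G : Type*} [Monoid G] (s : ℕ → G) : ℕ → G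
  | 0 => 1
  | k + 1 => s k * jucysMurphy s k * s k

section Map

variable {G H F : Type*} [Monoid G] [Monoid H] [FunLike F G H] [MonoidHomClass F G H]

theorem map_ascProd (f : F) (s : ℕ → G) (k : ℕ) :
    f (ascProd s k) = ascProd (fun i => f (s i)) k := by
  induction k with
  | zero => simp [ascProd]
  | succ k ih => simp [ascProd, ih]

theorem map_fundamental (f : F) (s : ℕ → G) (k : ℕ) :
    f (fundamental s k) = fundamental (fun i => f (s i)) k := by
  induction k with
  | zero => simp [fundamental]
  | succ k ih => simp [fundamental, ih, map_ascProd]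

theorem IsBraidSystem.map (f : F) {s : ℕ → G} {n : ℕ} (h : IsBraidSystem s n) :
    IsBraidSystem (fun i => f (s i)) n where
  braid i hi := by simp only [← map_mul, h.braid i hi]
  comm i j hij hj := (h.comm i j hij hj).map f

end Map

section Monoid

variable {G : Type*} [Monoid G] {s : ℕ → G} {n : ℕ}

theorem descProd_succ_mul (s : ℕ → G) (j m : ℕ) :
    descProd s (j + 1) m * s j = descProd s j (m + 1) := by
  induction m with
  | zero => simp [descProd]
  | succ m ih =>
    rw [descProd, mul_assoc, ih, descProd.eq_2 s j (m + 1), add_right_comm, add_assoc]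

theorem descProd_mul_ascProd (s : ℕ → G) (k : ℕ) :
    descProd s 0 k * ascProd s k = jucysMurphy s k := by
  induction k with
  | zero => simp [descProd, ascProd, jucysMurphy]
  | succ k ih =>
    rw [descProd, ascProd, jucysMurphy, ← ih, zero_add]
    simp only [mul_assoc]

theorem commute_ascProd {k : ℕ} {x : G} (h : ∀ i < k, Commute x (s i)) :
    Commute x (ascProd s k) := by
  induction k with
  | zero => exact Commute.one_right x
  | succ k ih => exact (ih fun i hi => h i (by lia)).mul_right (h k (by lia))

theorem commute_descProd {j m : ℕ} {x : G} (h : ∀ i, j ≤ i → i < j + m → Commute x (s i)) :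
    Commute x (descProd s j m) := by
  induction m with
  | zero => exact Commute.one_right x
  | succ m ih =>
    exact (h (j + m) (by lia) (by lia)).mul_right (ih fun i hi hi' => h i hi (by lia))

theorem commute_fundamental {k : ℕ} {x : G} (h : ∀ i < k, Commute x (s i)) :
    Commute x (fundamental s k) := by
  induction k with
  | zero => exact Commute.one_right x
  | succ k ih => exact (commute_ascProd h).mul_right (ih fun i hi => h i (by lia))

theorem commute_jucysMurphy {k : ℕ} {x : G} (h : ∀ i < k, Commute x (s i)) :
    Commute x (jucysMurphy s k) := by
  induction k with
  | zero => exact Commute.one_right x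
  | succ k ih =>
    exact ((h k (by lia)).mul_right (ih fun i hi => h i (by lia))).mul_right (h k (by lia))

namespace IsBraidSystem

theorem commute_jucysMurphy_of_lt (h : IsBraidSystem s n) {k j : ℕ} (hkj : k < j) (hj : j < n) :
    Commute (s j) (jucysMurphy s k) :=
  commute_jucysMurphy fun i hi => (h.comm i j (by lia) hj).symm

/-- If `j + 1 < k`, the new outer factors `s k` commute with `s j` and induction applies. The core
case is `t r x r t` with `r = s j`, `t = s (j + 1)`: two braid moves carry `r` across, since `t`
commutes with `x`. -/
theorem commute_jucysMurphy_of_gt (h : IsBraidSystem s n) {k : ℕ} :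
    ∀ {j : ℕ}, j + 1 < k → k ≤ n → Commute (s j) (jucysMurphy s k) := by
  induction k with
  | zero => intro j hj; lia
  | succ k ih =>
    intro j hj hk
    rcases Nat.lt_or_ge (j + 1) k with hjk | hjk
    · have h1 := h.comm j k (by lia) (by lia)
      exact (h1.mul_right (ih hjk (by lia))).mul_right h1
    · obtain rfl : k = j + 1 := by lia
      have hb := h.braid j (by lia)
      have hc := (h.commute_jucysMurphy_of_lt (Nat.lt_succ_self j) (by lia)).eq
      simp only [Nat.succ_eq_add_one] at hc
      simp only [jucysMurphy, Commute, SemiconjBy]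
      generalize s (j + 1) = t at *
      generalize jucysMurphy s j = x at *
      generalize s j = r at *
      calc r * (t * (r * x * r) * t) = r * t * r * x * r * t := by simp only [mul_assoc]
        _ = t * r * (t * x) * r * t := by rw [hb]; simp only [mul_assoc]
        _ = t * r * x * (t * r * t) := by rw [hc]; simp only [mul_assoc]
        _ = t * (r * x * r) * t * r := by rw [← hb]; simp only [mul_assoc]

theorem commute_jucysMurphy_jucysMurphy (h : IsBraidSystem s n) {j k : ℕ} (hj : j ≤ n)
    (hk : k ≤ n) : Commute (jucysMurphy s j) (jucysMurphy s k) := by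
  have key : ∀ {j k : ℕ}, j < k → k ≤ n → Commute (jucysMurphy s j) (jucysMurphy s k) :=
    fun {j k} hjk hk => (commute_jucysMurphy fun i hi =>
      (h.commute_jucysMurphy_of_gt (by lia) hk).symm).symm
  rcases lt_trichotomy j k with hjk | rfl | hjk
  · exact key hjk hk
  · exact Commute.refl _
  · exact (key hjk hj).symm

/-- The mirror image of the recursive definition; multiplying the two forms puts a Jucys–Murphy
element in the middle of the square. -/
theorem fundamental_succ_eq_mul_descProd (h : IsBraidSystem s n) {k : ℕ} (hk : k < n) :
    fundamental s (k + 1) = fundamental s k * descProd s 0 (k + 1) := by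
  induction k with
  | zero => simp [fundamental, ascProd, descProd]
  | succ k ih =>
    have hc : Commute (s (k + 1)) (fundamental s k) :=
      commute_fundamental fun i hi => (h.comm i (k + 1) (by lia) hk).symm
    calc fundamental s (k + 2)
        = ascProd s (k + 1) * s (k + 1) * fundamental s (k + 1) := rfl
      _ = ascProd s (k + 1) * (s (k + 1) * fundamental s k) * descProd s 0 (k + 1) := by
        rw [ih (by lia)]; simp only [mul_assoc]
      _ = fundamental s (k + 1) * (s (0 + (k + 1)) * descProd s 0 (k + 1)) := by
        rw [hc.eq, fundamental, zero_add]; simp only [mul_assoc]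

theorem fundamental_succ_sq (h : IsBraidSystem s n) {k : ℕ} (hk : k < n) :
    fundamental s (k + 1) ^ 2 = fundamental s k ^ 2 * jucysMurphy s (k + 1) := by
  have hc : Commute (jucysMurphy s (k + 1)) (fundamental s k) :=
    commute_fundamental fun i hi => (h.commute_jucysMurphy_of_gt (by lia) hk).symm
  calc fundamental s (k + 1) ^ 2
      = fundamental s k * (descProd s 0 (k + 1) * ascProd s (k + 1)) * fundamental s k := by
        rw [pow_two]
        nth_rewrite 1 [h.fundamental_succ_eq_mul_descProd hk]
        rw [fundamental]
        simp only [mul_assoc]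
    _ = fundamental s k ^ 2 * jucysMurphy s (k + 1) := by
        rw [descProd_mul_ascProd, mul_assoc, hc.eq, pow_two, mul_assoc]

/-- A generator passing through a descending run has its index lowered by one, by a single braid
move where it meets its neighbour. -/
theorem descProd_mul_succ (h : IsBraidSystem s n) {i j : ℕ} (hji : j ≤ i) {m : ℕ}
    (him : i + 1 < j + m) (hm : j + m ≤ n) :
    descProd s j m * s (i + 1) = s i * descProd s j m := by
  induction m with
  | zero => lia
  | succ m ih =>
    rcases Nat.lt_or_ge (i + 1) (j + m) with hlt | hge
    · rw [descProd, mul_assoc, ih hlt (by lia), ← mul_assoc, ← mul_assoc,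
        (h.comm i (j + m) (by lia) (by lia)).eq]
    · obtain ⟨m, rfl⟩ : ∃ m', m = m' + 1 := ⟨m - 1, by lia⟩
      obtain rfl : i = j + m := by lia
      have hc : Commute (s (j + m + 1)) (descProd s j m) :=
        commute_descProd fun l _ hl => (h.comm l _ (by lia) (by lia)).symm
      calc s (j + m + 1) * (s (j + m) * descProd s j m) * s (j + m + 1)
          = s (j + m + 1) * s (j + m) * (descProd s j m * s (j + m + 1)) := by
            simp only [mul_assoc]
        _ = s (j + m + 1) * s (j + m) * s (j + m + 1) * descProd s j m := by
            rw [← hc.eq]; simp only [mul_assoc]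
        _ = s (j + m) * (s (j + m + 1) * (s (j + m) * descProd s j m)) := by
            rw [← h.braid _ (by lia)]; simp only [mul_assoc]

end IsBraidSystem
end Monoid

/-! ### Spanning by `(n + 1)!` elements -/

section Span

open scoped Pointwise Nat

variable {K A : Type*} [CommRing K] [Ring A] [Algebra K A] {s : ℕ → A} {n : ℕ}

/-- An algebra generated by a braid system of length `n` with quadratic relations is spanned by
`(n + 1)!` elements. -/
theorem IsBraidSystem.exists_card_le_factorial (h : IsBraidSystem s n) {t c : K}
    (hq : ∀ i < n, s i * s i = t • s i + c • 1) {k : ℕ} (hk : k ≤ n) :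
    ∃ B : Finset A, B.card ≤ (k + 1)! ∧ 1 ∈ Submodule.span K (B : Set A) ∧
      ∀ i < k, ∀ x ∈ Submodule.span K (B : Set A), x * s i ∈ Submodule.span K (B : Set A) := by
  classical
  induction k with
  | zero => exact ⟨{1}, by simp, Submodule.subset_span (by simp), by simp⟩
  | succ k ih =>
    obtain ⟨B, hB, h1, hmul⟩ := ih (by lia)
    -- Descending runs ending at `s j`, with `j = k + 1` giving the empty run: the `k + 2` coset
    -- representatives of one symmetric group in the next.
    set C : Finset A := (Finset.range (k + 2)).image fun j => descProd s j (k + 1 - j) with hC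
    have hmem : ∀ j m, j + m = k + 1 → descProd s j m ∈ C := fun j m hjm =>
      Finset.mem_image.2 ⟨j, by simp; lia, by rw [show k + 1 - j = m by lia]⟩
    have hmulmem : ∀ x ∈ Submodule.span K (B : Set A), ∀ j m, j + m = k + 1 →
        x * descProd s j m ∈ Submodule.span K ((B * C : Finset A) : Set A) := by
      intro x hx j m hjm
      rw [Finset.coe_mul, ← Submodule.span_mul_span]
      exact Submodule.mul_mem_mul hx (Submodule.subset_span (hmem j m hjm))
    refine ⟨B * C, ?_, ?_, ?_⟩
    · refine Finset.card_mul_le.trans ?_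
      rw [Nat.factorial_succ (k + 1), mul_comm]
      exact Nat.mul_le_mul (Finset.card_image_le.trans (by simp)) hB
    · simpa [descProd] using hmulmem 1 h1 (k + 1) 0 rfl
    · intro i hi x hx
      induction hx using Submodule.span_induction with
      | zero => simp
      | add x y _ _ hx hy => rw [add_mul]; exact add_mem hx hy
      | smul a x _ hx => rw [smul_mul_assoc]; exact Submodule.smul_mem _ _ hx
      | mem x hx =>
        obtain ⟨b, hb, d, hd, rfl⟩ := Finset.mem_mul.1 hx
        obtain ⟨j, hj, rfl⟩ := Finset.mem_image.1 hd
        have hj : j < k + 2 := Finset.mem_range.1 hj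
        have hb : b ∈ Submodule.span K (B : Set A) := Submodule.subset_span hb
        obtain ⟨m, hm⟩ : ∃ m, j + m = k + 1 := ⟨k + 1 - j, by lia⟩
        rw [show k + 1 - j = m by lia, mul_assoc]
        -- Right multiplication by `s i` commutes past the run, lengthens it, shortens it by the
        -- quadratic relation (`i = j`), or passes through as `s (i - 1)`.
        rcases lt_trichotomy (i + 1) j with hij | rfl | hij
        · have hc : Commute (s i) (descProd s j m) :=
            commute_descProd fun l hl hl' => h.comm i l (by lia) (by lia)
          rw [← hc.eq, ← mul_assoc]
          exact hmulmem _ (hmul i (by lia) b hb) j m hm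
        · rw [descProd_succ_mul]
          exact hmulmem b hb i (m + 1) (by lia)
        · rcases Nat.eq_or_lt_of_le (Nat.le_of_lt_succ hij) with rfl | hij
          · obtain ⟨m, rfl⟩ : ∃ m', m = m' + 1 := ⟨m - 1, by lia⟩
            rw [← descProd_succ_mul, mul_assoc, hq j (by lia), mul_add, mul_smul_comm,
              mul_smul_comm, mul_one, descProd_succ_mul, mul_add, mul_smul_comm, mul_smul_comm]
            exact add_mem (Submodule.smul_mem _ _ (hmulmem b hb j (m + 1) hm))
              (Submodule.smul_mem _ _ (hmulmem b hb (j + 1) m (by lia)))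
          · obtain ⟨i, rfl⟩ : ∃ i', i = i' + 1 := ⟨i - 1, by lia⟩
            rw [h.descProd_mul_succ (by lia) (by lia) (by lia), ← mul_assoc]
            exact hmulmem _ (hmul i (by lia) b hb) j m hm

end Span

/-! ### Joint eigenvalues of the Jucys–Murphy elements -/

section Eigenvalue

variable {V : Type*} [AddCommGroup V] [Module ℝ V] {s : ℕ → Module.End ℝ V} {n : ℕ}

/-- The eigenvalues of the Jucys–Murphy elements on joint eigenvectors. -/
theorem IsBraidSystem.exists_jucysMurphy_eigenvalue (h : IsBraidSystem s n) {u₀ u₁ : ℝ}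
    (h₀ : u₀ ≠ 0) (h₁ : u₁ ≠ 0)
    (hq : ∀ i < n, s i * s i = (u₀ + u₁) • s i + (-(u₀ * u₁)) • 1) {k : ℕ} (hk : k ≤ n) :
    ∀ (χ : ℕ → ℝ) (v : V), v ≠ 0 → (∀ j ≤ k, jucysMurphy s j v = χ j • v) →
      ∃ a b, a + b = 2 * k ∧ χ k = u₀ ^ a * (-u₁) ^ b := by
  induction k with
  | zero =>
    intro χ v hv hχ
    refine ⟨0, 0, rfl, ?_⟩
    have h0 := hχ 0 le_rfl
    simp only [jucysMurphy, Module.End.one_apply] at h0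
    have : (χ 0 - 1) • v = 0 := by rw [sub_smul, ← h0, one_smul, sub_self]
    simpa [sub_eq_zero, hv] using this
  | succ k ih =>
    intro χ v hv hχ
    obtain ⟨a, b, hab, hχk⟩ := ih (by lia) χ v hv fun j hj => hχ j (by lia)
    have hqv : ∀ x, s k (s k x) = (u₀ + u₁) • s k x + (-(u₀ * u₁)) • x := fun x => by
      simpa using LinearMap.congr_fun (hq k (by lia)) x
    have hX := hχ k (by lia)
    have hY : s k (jucysMurphy s k (s k v)) = χ (k + 1) • v := hχ (k + 1) le_rfl
    have huu : -(u₀ * u₁) ≠ 0 := neg_ne_zero.2 (mul_ne_zero h₀ h₁)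
    -- `β` is the second eigenvalue expected for `L_k` on the span of `v` and `s k v`, as `hXT`
    -- suggests. If it has the required form, so does `χ (k + 1) = u₀ (-u₁) β`.
    obtain ⟨β, hβ⟩ : ∃ β, χ (k + 1) = -(u₀ * u₁) * β := ⟨χ (k + 1) / (-(u₀ * u₁)), by field_simp⟩
    have hXT : jucysMurphy s k (s k v) = β • (s k v - (u₀ + u₁) • v) := by
      have h2 := hqv (jucysMurphy s k (s k v))
      rw [hY, map_smul, hβ] at h2
      have h3 : (-(u₀ * u₁)) • jucysMurphy s k (s k v)
          = (-(u₀ * u₁)) • (β • (s k v - (u₀ + u₁) • v)) := by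
        rw [← sub_eq_iff_eq_add'] at h2
        rw [← h2]
        module
      exact smul_right_injective V huu h3
    by_cases hβa : χ k = β
    · refine ⟨a + 1, b + 1, by lia, ?_⟩
      rw [hβ, ← hβa, hχk]
      ring
    have hsub : χ k - β ≠ 0 := sub_ne_zero.2 hβa
    -- `γ` is chosen so that `L_k` maps `s k v + γ • v` to `β` times itself.
    obtain ⟨γ, hγ⟩ : ∃ γ, γ * (χ k - β) = β * (u₀ + u₁) :=
      ⟨β * (u₀ + u₁) / (χ k - β), by field_simp⟩
    -- If this vector vanishes, `v` is an eigenvector of `s k` with value `u₀` or `u₁`, whose square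
    -- multiplies `χ k`. Otherwise it is a joint eigenvector to which the induction hypothesis
    -- applies, with `β` in place of `χ k`.
    by_cases hw : s k v + γ • v = 0
    · have hTv : s k v = (-γ) • v := by rw [neg_smul]; exact eq_neg_of_add_eq_zero_left hw
      have hroot : (-γ - u₀) * (-γ - u₁) = 0 := by
        have h2 := hqv v
        simp only [hTv, map_smul, smul_smul, ← add_smul] at h2
        have h3 := smul_left_injective ℝ hv h2
        linear_combination h3
      have hval : χ (k + 1) = (-γ) ^ 2 * χ k := by
        simp only [hTv, map_smul, hX, smul_smul] at hY
        have h3 := smul_left_injective ℝ hv hY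
        linear_combination -h3
      rcases mul_eq_zero.1 hroot with h4 | h4
      · refine ⟨a + 2, b, by lia, ?_⟩
        rw [hval, sub_eq_zero.1 h4, hχk]; ring
      · refine ⟨a, b + 2, by lia, ?_⟩
        rw [hval, sub_eq_zero.1 h4, hχk]; ring
    · obtain ⟨a', b', hab', hβ'⟩ := ih (by lia) (fun j => if j = k then β else χ j) _ hw (by
        intro j hj
        rcases Nat.eq_or_lt_of_le hj with rfl | hj
        · simp only [if_true, map_add, map_smul, hXT, hX]
          have : (γ * χ j) • v = (β * (u₀ + u₁) + γ * β) • v := by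
            congr 1; linear_combination hγ
          rw [smul_smul γ, this]
          module
        · have hc : jucysMurphy s j (s k v) = s k (jucysMurphy s j v) :=
            (LinearMap.congr_fun (h.commute_jucysMurphy_of_lt hj (by lia)).eq v).symm
          simp only [if_neg hj.ne, map_add, map_smul, hc, hχ j (by lia)]
          module)
      refine ⟨a' + 1, b' + 1, by lia, ?_⟩
      simp only [if_true] at hβ'
      rw [hβ, hβ']
      ring

/-- The eigenvalues of the square of the fundamental element on joint eigenvectors of the
Jucys–Murphy elements. -/
theorem IsBraidSystem.exists_fundamental_sq_eigenvalue (h : IsBraidSystem s n) {u₀ u₁ : ℝ}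
    (h₀ : u₀ ≠ 0) (h₁ : u₁ ≠ 0)
    (hq : ∀ i < n, s i * s i = (u₀ + u₁) • s i + (-(u₀ * u₁)) • 1) {χ : ℕ → ℝ} {v : V}
    (hv : v ≠ 0) {k : ℕ} (hk : k ≤ n) (hχ : ∀ j ≤ k, jucysMurphy s j v = χ j • v) :
    ∃ a b, a + b = k * (k + 1) ∧ (fundamental s k ^ 2) v = (u₀ ^ a * (-u₁) ^ b) • v := by
  induction k with
  | zero => exact ⟨0, 0, rfl, by simp [fundamental]⟩
  | succ k ih =>
    obtain ⟨a, b, hab, hv'⟩ := ih (by lia) fun j hj => hχ j (by lia)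
    obtain ⟨a', b', hab', hχ'⟩ := h.exists_jucysMurphy_eigenvalue h₀ h₁ hq hk χ v hv hχ
    refine ⟨a + a', b + b', by lia, ?_⟩
    rw [h.fundamental_succ_sq (by lia), Module.End.mul_apply, hχ _ le_rfl, map_smul, hv', hχ',
      smul_smul]
    congr 1
    ring

end Eigenvalue


/-! ### The action on the free module on permutations -/

section Model

variable {ι A : Type*} [Fintype ι] [LinearOrder ι] [CommRing A]

open Equiv (Perm swap)

/-- The matrix by which a generator of the Hecke algebra acts on the free module on permutations:
the permutation `w` is sent to `α • (w * swap a b)` if `w a < w b`, and to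
`t • w + β • (w * swap a b)` otherwise. -/
def heckeMatrix (t α β : A) (a b : ι) : Matrix (Perm ι) (Perm ι) A :=
  Matrix.of fun v w => if w a < w b then (if v = w * swap a b then α else 0)
    else (if v = w then t else 0) + (if v = w * swap a b then β else 0)

theorem heckeMatrix_mulVec_single (t α β : A) (a b : ι) (w : Perm ι) :
    (heckeMatrix t α β a b).mulVec (Pi.single w 1) =
      if w a < w b then α • Pi.single (w * swap a b) 1
      else t • Pi.single w 1 + β • Pi.single (w * swap a b) 1 := by
  ext v
  rw [Matrix.mulVec_single_one]
  split_ifs with h <;> simp [heckeMatrix, h, Pi.single_apply]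

theorem heckeMatrix_map {B : Type*} [CommRing B] (φ : A →+* B) (t α β : A) (a b : ι) :
    φ.mapMatrix (heckeMatrix t α β a b) = heckeMatrix (φ t) (φ α) (φ β) a b := by
  ext v w
  simp only [RingHom.mapMatrix_apply, Matrix.map_apply, heckeMatrix, Matrix.of_apply]
  split_ifs <;> simp

theorem heckeMatrix_transpose (t α : A) {a b : ι} (hab : a ≠ b) :
    (heckeMatrix t α α a b).transpose = heckeMatrix t α α a b := by
  ext v w
  have hs : v = w * swap a b ↔ w = v * swap a b := by
    constructor <;> rintro rfl <;> simp [mul_assoc]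
  have hne : w ≠ w * swap a b := fun h => by simp [hab] at h
  simp only [Matrix.transpose_apply, heckeMatrix, Matrix.of_apply, ← hs]
  by_cases h : v = w
  · subst h; rfl
  · simp [h, Ne.symm h]

theorem heckeMatrix_mul_self (t α β : A) {a b : ι} (hab : a ≠ b) :
    heckeMatrix t α β a b * heckeMatrix t α β a b =
      t • heckeMatrix t α β a b + (α * β) • 1 := by
  refine Matrix.ext_of_mulVec_single fun w => ?_
  have hne : w a ≠ w b := fun h => hab (w.injective h)
  rw [Matrix.add_mulVec, Matrix.smul_mulVec, Matrix.smul_mulVec, Matrix.one_mulVec,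
    ← Matrix.mulVec_mulVec]
  have hsq : w * swap a b * swap a b = w := by simp [mul_assoc]
  rcases lt_or_gt_of_ne hne with h | h <;>
  · simp only [heckeMatrix_mulVec_single, Matrix.mulVec_smul, Matrix.mulVec_add, h, h.not_gt, hsq,
      Equiv.Perm.mul_apply, Equiv.swap_apply_left, Equiv.swap_apply_right, if_true, if_false]
    module

theorem heckeMatrix_commute (t α β : A) {a b c d : ι} (hab : a ≠ b) (hcd : c ≠ d)
    (hac : a ≠ c) (had : a ≠ d) (hbc : b ≠ c) (hbd : b ≠ d) :
    Commute (heckeMatrix t α β a b) (heckeMatrix t α β c d) := by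
  refine Matrix.ext_of_mulVec_single fun w => ?_
  have hs : w * swap a b * swap c d = w * swap c d * swap a b := by
    rw [mul_assoc, mul_assoc, (Equiv.Perm.disjoint_swap_swap (by
      simp [*])).commute.eq]
  have e1 : swap c d a = a := Equiv.swap_apply_of_ne_of_ne hac had
  have e2 : swap c d b = b := Equiv.swap_apply_of_ne_of_ne hbc hbd
  have e3 : swap a b c = c := Equiv.swap_apply_of_ne_of_ne hac.symm hbc.symm
  have e4 : swap a b d = d := Equiv.swap_apply_of_ne_of_ne had.symm hbd.symm
  simp only [← Matrix.mulVec_mulVec]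
  by_cases h : w a < w b <;> by_cases h' : w c < w d <;>
  · simp only [heckeMatrix_mulVec_single, Matrix.mulVec_smul, Matrix.mulVec_add, h, h', e1, e2, e3,
      e4, hs, Equiv.Perm.mul_apply, if_true, if_false] <;> module

/-- On the basis vector of `w` only the relative order of `w a`, `w b`, `w c` matters. Two of the
eight sign patterns violate transitivity; the other six are direct computations. -/
theorem heckeMatrix_braid (t α β : A) {a b c : ι} (hab : a ≠ b) (hbc : b ≠ c) (hac : a ≠ c) :
    heckeMatrix t α β a b * heckeMatrix t α β b c * heckeMatrix t α β a b =
      heckeMatrix t α β b c * heckeMatrix t α β a b * heckeMatrix t α β b c := by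
  refine Matrix.ext_of_mulVec_single fun w => ?_
  have hs : w * swap a b * swap b c * swap a b = w * swap b c * swap a b * swap b c := by
    ext x
    have hba := hab.symm
    have hcb := hbc.symm
    have hca := hac.symm
    by_cases hxa : x = a <;> by_cases hxb : x = b <;> by_cases hxc : x = c <;>
      simp_all [Equiv.swap_apply_def]
  have e1 : swap a b c = c := Equiv.swap_apply_of_ne_of_ne hac.symm hbc.symm
  have e2 : swap b c a = a := Equiv.swap_apply_of_ne_of_ne hab hac
  have nab : w a ≠ w b := fun h => hab (w.injective h)
  have nbc : w b ≠ w c := fun h => hbc (w.injective h)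
  have nac : w a ≠ w c := fun h => hac (w.injective h)
  have hsq : ∀ (v : Perm ι) (x y : ι), v * swap x y * swap x y = v := fun v x y => by
    simp [mul_assoc]
  simp only [← Matrix.mulVec_mulVec]
  rcases lt_or_gt_of_ne nab with h1 | h1 <;> rcases lt_or_gt_of_ne nbc with h2 | h2 <;>
  rcases lt_or_gt_of_ne nac with h3 | h3 <;>
  first
  | exact absurd (h1.trans h2) h3.not_gt
  | exact absurd (h2.trans h1) h3.not_gt
  | (simp only [heckeMatrix_mulVec_single, Matrix.mulVec_smul, Matrix.mulVec_add, h1, h2, h3,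
      h1.not_gt, h2.not_gt, h3.not_gt, e1, e2, hs, hsq, Equiv.Perm.mul_apply,
      Equiv.swap_apply_left, Equiv.swap_apply_right, if_true, if_false] <;> module)

end Model

/-- The matrices by which the generators of the Hecke algebra of type `A_n` act, continued by `1`. -/
def modelGen {A : Type*} [CommRing A] (n : ℕ) (t α β : A) (i : ℕ) :
    Matrix (Equiv.Perm (Fin (n + 1))) (Equiv.Perm (Fin (n + 1))) A :=
  if h : i < n then heckeMatrix t α β (Fin.castSucc ⟨i, h⟩) (Fin.succ ⟨i, h⟩) else 1

section ModelGen

variable {A : Type*} [CommRing A] {n : ℕ}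

theorem isBraidSystem_modelGen (t α β : A) : IsBraidSystem (modelGen n t α β) n where
  braid i hi := by
    simp only [modelGen, hi, (Nat.lt_succ_self i).trans hi, dif_pos]
    exact heckeMatrix_braid t α β (by simp [Fin.ext_iff]) (by simp [Fin.ext_iff])
      (by simp [Fin.ext_iff]; lia)
  comm i j hij hj := by
    simp only [modelGen, hj, show i < n by lia, dif_pos]
    apply heckeMatrix_commute <;> simp [Fin.ext_iff] <;> lia

theorem modelGen_mul_self (t α β : A) {i : ℕ} (hi : i < n) :
    modelGen n t α β i * modelGen n t α β i = t • modelGen n t α β i + (α * β) • 1 := by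
  simp only [modelGen, hi, dif_pos]
  exact heckeMatrix_mul_self t α β (by simp [Fin.ext_iff])

theorem modelGen_transpose (t α : A) (i : ℕ) :
    (modelGen n t α α i).transpose = modelGen n t α α i := by
  unfold modelGen
  split_ifs
  · exact heckeMatrix_transpose t α (by simp [Fin.ext_iff])
  · exact Matrix.transpose_one

theorem modelGen_map {B : Type*} [CommRing B] (φ : A →+* B) (t α β : A) (i : ℕ) :
    φ.mapMatrix (modelGen n t α β i) = modelGen n (φ t) (φ α) (φ β) i := by
  unfold modelGen
  split_ifs
  · exact heckeMatrix_map φ t α β _ _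
  · exact map_one _

end ModelGen

/-! ### The braid group, the Hecke algebra and its universal property -/

/-- The Artin generators, continued by `1`. -/
def braidGen (n : ℕ) (i : ℕ) : BraidGroup n := if h : i < n then artinGen ⟨i, h⟩ else 1

theorem isBraidSystem_braidGen (n : ℕ) : IsBraidSystem (braidGen n) n where
  braid i hi := by
    simp only [braidGen, hi, (Nat.lt_succ_self i).trans hi, dif_pos]
    exact PresentedGroup.mk_eq_mk_of_mul_inv_mem (Or.inl ⟨_, _, rfl, rfl⟩)
  comm i j hij hj := by
    simp only [braidGen, hj, show i < n by lia, dif_pos]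
    exact PresentedGroup.mk_eq_mk_of_mul_inv_mem (Or.inr ⟨⟨i, by lia⟩, ⟨j, hj⟩, hij, rfl⟩)

theorem ascProd_eq_prod_ofFn {G : Type*} [Monoid G] (s : ℕ → G) (k : ℕ) :
    ascProd s k = (List.ofFn fun i : Fin k => s i).prod := by
  induction k with
  | zero => simp [ascProd]
  | succ k ih => rw [ascProd, ih, List.ofFn_succ', List.concat_eq_append, List.prod_append]; simp

theorem fundamental_eq_prod_ofFn {G : Type*} [Monoid G] (s : ℕ → G) (k : ℕ) :
    fundamental s k = (List.ofFn fun i : Fin k => ascProd s (k - i)).prod := by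
  induction k with
  | zero => simp [fundamental]
  | succ k ih => simp [fundamental, ih, List.ofFn_succ]

theorem initialProduct_eq {n : ℕ} (t : Fin n) :
    initialProduct t = ascProd (braidGen n) (t + 1) := by
  rw [ascProd_eq_prod_ofFn, initialProduct]
  congr 2
  funext i
  rw [braidGen, dif_pos (by have := i.isLt; have := t.isLt; lia)]
  rfl

theorem garside_eq_fundamental (n : ℕ) : garside n = fundamental (braidGen n) n := by
  rw [fundamental_eq_prod_ofFn, garside]
  congr 2
  funext i
  rw [initialProduct_eq, Fin.val_rev]
  congr 1
  have := i.isLt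
  lia

variable {K : Type*} [CommRing K] {n : ℕ}

/-- `toHecke` as a monoid homomorphism. -/
noncomputable def toHeckeHom (u₀ u₁ : Kˣ) : BraidGroup n →* HeckeAlgebra n u₀ u₁ :=
  (RingQuot.mkAlgHom K (HeckeRel n u₀ u₁) : _ →* _).comp (MonoidAlgebra.of K (BraidGroup n))

theorem toHecke_garside (u₀ u₁ : Kˣ) :
    toHecke u₀ u₁ (garside n) = fundamental (fun i => toHeckeHom u₀ u₁ (braidGen n i)) n := by
  rw [← map_fundamental, ← garside_eq_fundamental]
  rfl

theorem mul_self_eq_of_sub_mul_sub_eq_zero {R : Type*} [Ring R] [Algebra K R] {x : R} {u v : K}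
    (h : (x - algebraMap K R u) * (x - algebraMap K R v) = 0) :
    x * x = (u + v) • x + (-(u * v)) • 1 := by
  rw [sub_mul, mul_sub, mul_sub, ← Algebra.commutes v x, ← Algebra.smul_def, ← Algebra.smul_def,
    ← Algebra.smul_def, Algebra.algebraMap_eq_smul_one, smul_smul] at h
  have h2 : x * x = (x * x - v • x - (u • x - (u * v) • (1 : R)))
    + ((u + v) • x + (-(u * v)) • 1) := by module
  rw [h2, h, zero_add]

theorem sub_mul_sub_eq_zero {R : Type*} [Ring R] [Algebra K R] {x : R} {u v : K}
    (h : x * x = (u + v) • x + (-(u * v)) • 1) :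
    (x - algebraMap K R u) * (x - algebraMap K R v) = 0 := by
  rw [sub_mul, mul_sub, mul_sub, ← Algebra.commutes v x, ← Algebra.smul_def, ← Algebra.smul_def,
    ← Algebra.smul_def, Algebra.algebraMap_eq_smul_one, smul_smul, h]
  module

theorem toHeckeHom_mul_self (u₀ u₁ : Kˣ) {i : ℕ} (hi : i < n) :
    toHeckeHom u₀ u₁ (braidGen n i) * toHeckeHom u₀ u₁ (braidGen n i) =
      ((u₀ : K) + u₁) • toHeckeHom u₀ u₁ (braidGen n i) + (-((u₀ : K) * u₁)) • 1 := by
  apply mul_self_eq_of_sub_mul_sub_eq_zero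
  have h := RingQuot.mkAlgHom_rel K (HeckeRel.quadratic (u₀ := u₀) (u₁ := u₁) (braidGen n i)
    ⟨⟨i, hi⟩, by rw [braidGen, dif_pos hi]⟩)
  rw [map_mul, map_sub, map_sub, AlgHom.commutes, AlgHom.commutes, map_zero] at h
  exact h

section Representation

variable {R : Type*} [Ring R] [Algebra K R] {s : ℕ → R}

/-- A root of `(X - u₀) (X - u₁)` with `u₀`, `u₁` invertible is invertible. -/
def unitOfQuadratic (u₀ u₁ : Kˣ) (x : R)
    (h : x * x = ((u₀ : K) + u₁) • x + (-((u₀ : K) * u₁)) • 1) : Rˣ where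
  val := x
  inv := (↑(u₀ * u₁)⁻¹ : K) • (((u₀ : K) + u₁) • 1 - x)
  val_inv := by
    rw [mul_smul_comm, mul_sub, h, mul_smul_comm, mul_one, sub_add_cancel_left, neg_smul, neg_neg,
      smul_smul, ← Units.val_mul, ← Units.val_mul, inv_mul_cancel, Units.val_one, one_smul]
  inv_val := by
    rw [smul_mul_assoc, sub_mul, h, smul_mul_assoc, one_mul, sub_add_cancel_left, neg_smul,
      neg_neg, smul_smul, ← Units.val_mul, ← Units.val_mul, inv_mul_cancel, Units.val_one,
      one_smul]

theorem coe_unitOfQuadratic (u₀ u₁ : Kˣ) (x : R)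
    (h : x * x = ((u₀ : K) + u₁) • x + (-((u₀ : K) * u₁)) • 1) :
    (unitOfQuadratic u₀ u₁ x h : R) = x :=
  rfl

/-- The group homomorphism from the braid group given by a braid system with quadratic
relations. -/
def braidLift (u₀ u₁ : Kˣ) (h : IsBraidSystem s n)
    (hq : ∀ i < n, s i * s i = ((u₀ : K) + u₁) • s i + (-((u₀ : K) * u₁)) • 1) :
    BraidGroup n →* Rˣ :=
  PresentedGroup.toGroup (f := fun i : Fin n => unitOfQuadratic u₀ u₁ (s i) (hq i i.isLt)) (by
    rintro r (⟨i, j, hij, rfl⟩ | ⟨i, j, hij, rfl⟩)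
    · rw [map_mul, map_inv, mul_inv_eq_one]
      ext
      simpa [coe_unitOfQuadratic, ← hij] using h.braid i (by have := j.isLt; lia)
    · rw [map_mul, map_inv, mul_inv_eq_one]
      ext
      simpa [coe_unitOfQuadratic] using (h.comm i j hij j.isLt).eq)

theorem braidLift_artinGen (u₀ u₁ : Kˣ) (h : IsBraidSystem s n)
    (hq : ∀ i < n, s i * s i = ((u₀ : K) + u₁) • s i + (-((u₀ : K) * u₁)) • 1) (i : Fin n) :
    (braidLift u₀ u₁ h hq (artinGen i) : R) = s i := by
  simp [braidLift, artinGen, coe_unitOfQuadratic, PresentedGroup.toGroup.of]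

/-- The algebra homomorphism from the Hecke algebra given by a braid system with quadratic
relations. -/
noncomputable def heckeLift (u₀ u₁ : Kˣ) (h : IsBraidSystem s n)
    (hq : ∀ i < n, s i * s i = ((u₀ : K) + u₁) • s i + (-((u₀ : K) * u₁)) • 1) :
    HeckeAlgebra n u₀ u₁ →ₐ[K] R :=
  RingQuot.liftAlgHom K ⟨MonoidAlgebra.lift K R (BraidGroup n)
    ((Units.coeHom R).comp (braidLift u₀ u₁ h hq)), by
      rintro _ _ ⟨b, i, hb⟩
      obtain ⟨c, hc⟩ := isConj_iff.1 hb
      have hi := sub_mul_sub_eq_zero (hq i i.isLt)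
      rw [← braidLift_artinGen u₀ u₁ h hq i] at hi
      set f := braidLift u₀ u₁ h hq
      -- The Hecke relations concern all conjugates, `hq` only the generators; conjugating by `f c`
      -- bridges the two.
      have hconj : ∀ u : K, (f b : R) - algebraMap K R u =
          f c * ((f (artinGen i) : R) - algebraMap K R u) * ↑(f c)⁻¹ := fun u => by
        rw [mul_sub, sub_mul, ← Algebra.commutes, mul_assoc (algebraMap K R u), Units.mul_inv,
          mul_one, ← hc, map_mul, map_mul, map_inv, Units.val_mul, Units.val_mul]
      have hb : ((f b : R) - algebraMap K R u₀) * ((f b : R) - algebraMap K R u₁) = 0 := by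
        rw [hconj, hconj]
        calc _ = f c * ((f (artinGen i) : R) - algebraMap K R u₀) * (↑(f c)⁻¹ * ↑(f c)) *
              ((f (artinGen i) : R) - algebraMap K R u₁) * ↑(f c)⁻¹ := by simp only [mul_assoc]
          _ = 0 := by rw [Units.inv_mul, mul_one, mul_assoc (f c : R), hi]; simp
      simpa [← Algebra.algebraMap_eq_smul_one] using hb⟩

theorem heckeLift_braidGen (u₀ u₁ : Kˣ) (h : IsBraidSystem s n)
    (hq : ∀ i < n, s i * s i = ((u₀ : K) + u₁) • s i + (-((u₀ : K) * u₁)) • 1) {i : ℕ}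
    (hi : i < n) : heckeLift u₀ u₁ h hq (toHeckeHom u₀ u₁ (braidGen n i)) = s i := by
  simp [heckeLift, toHeckeHom, braidGen, hi, braidLift_artinGen]

end Representation

section Span

/-- A submodule of the Hecke algebra containing `1` and stable under right multiplication by the
generators is everything. -/
theorem hecke_submodule_eq_top (u₀ u₁ : Kˣ) (N : Submodule K (HeckeAlgebra n u₀ u₁)) (h1 : 1 ∈ N)
    (hN : ∀ i < n, ∀ x ∈ N, x * toHeckeHom u₀ u₁ (braidGen n i) ∈ N) : N = ⊤ := by
  have hgen : ∀ i : Fin n, ∀ x ∈ N, x * toHeckeHom u₀ u₁ (PresentedGroup.of i) ∈ N := by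
    intro i x hx
    simpa [braidGen, artinGen] using hN i i.isLt x hx
  -- By the quadratic relation the inverse of a generator is a linear combination of `1` and that
  -- generator.
  have hinv : ∀ i : Fin n, ∀ x ∈ N, x * toHeckeHom u₀ u₁ (PresentedGroup.of i)⁻¹ ∈ N := by
    intro i x hx
    have hq := toHeckeHom_mul_self u₀ u₁ i.isLt
    set y := toHeckeHom u₀ u₁ (braidGen n i) with hy
    have hyi : toHeckeHom u₀ u₁ (PresentedGroup.of i)⁻¹ = ↑(unitOfQuadratic u₀ u₁ y hq)⁻¹ := by
      refine (Units.inv_eq_of_mul_eq_one_right ?_).symm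
      change y * _ = 1
      rw [hy, ← map_mul]
      simp [braidGen, artinGen]
    rw [hyi]
    change x * ((↑(u₀ * u₁)⁻¹ : K) • (((u₀ : K) + u₁) • 1 - y)) ∈ N
    rw [mul_smul_comm, mul_sub, mul_smul_comm, mul_one]
    exact N.smul_mem _ (N.sub_mem (N.smul_mem _ hx) (hN i i.isLt x hx))
  have hgrp : ∀ g : BraidGroup n, ∀ x ∈ N, x * toHeckeHom u₀ u₁ g ∈ N := by
    intro g
    induction g using PresentedGroup.induction_on with
    | _ z =>
      induction z using FreeGroup.induction_on with
      | C1 => intro x hx; simpa using hx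
      | of i => exact hgen i
      | inv_of i _ => exact hinv i
      | mul a b ha hb =>
        intro x hx
        rw [map_mul, map_mul, ← mul_assoc]
        exact hb _ (ha x hx)
  refine eq_top_iff.2 fun x _ => ?_
  obtain ⟨x, rfl⟩ := RingQuot.mkAlgHom_surjective K (HeckeRel n u₀ u₁) x
  induction x using MonoidAlgebra.induction_on with
  | of g => exact one_mul (toHeckeHom u₀ u₁ g) ▸ hgrp g 1 h1
  | add x y hx hy => rw [map_add]; exact N.add_mem (hx trivial) (hy trivial)
  | smul a x hx => rw [map_smul]; exact N.smul_mem _ (hx trivial)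

theorem hecke_exists_span_eq_top (u₀ u₁ : Kˣ) : ∃ B : Finset (HeckeAlgebra n u₀ u₁),
    B.card ≤ (n + 1).factorial ∧ Submodule.span K (B : Set (HeckeAlgebra n u₀ u₁)) = ⊤ := by
  obtain ⟨B, hB, h1, hmul⟩ :=
    ((isBraidSystem_braidGen n).map (toHeckeHom u₀ u₁)).exists_card_le_factorial
      (fun i hi => toHeckeHom_mul_self u₀ u₁ hi) le_rfl
  exact ⟨B, hB, hecke_submodule_eq_top u₀ u₁ _ h1 hmul⟩

end Span

/-! ### Faithfulness of the matrix model -/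

/-- A surjective linear map onto a free module from a module spanned by at most as many elements
as the rank is injective. -/
theorem injective_of_surjective_of_card_le {ι M : Type*} [Fintype ι] [AddCommGroup M] [Module K M]
    (B : Finset M) (hB : B.card ≤ Fintype.card ι) (hspan : Submodule.span K (B : Set M) = ⊤)
    (f : M →ₗ[K] ι → K) (hf : Function.Surjective f) : Function.Injective f := by
  obtain ⟨e⟩ := Function.Embedding.nonempty_of_card_le (α := B) (β := ι) (by simpa using hB)
  let g : (ι → K) →ₗ[K] M :=
    (Fintype.linearCombination K (Subtype.val : B → M)).comp (LinearMap.funLeft K K e)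
  have hlin : Function.Surjective (Fintype.linearCombination K (Subtype.val : B → M)) := by
    rw [← LinearMap.range_eq_top, Fintype.range_linearCombination]
    simpa using hspan
  have hg : Function.Surjective g :=
    hlin.comp (LinearMap.funLeft_surjective_of_injective K K e e.injective)
  -- A surjective endomorphism of a finite free module is injective; as `g` is surjective, `f`
  -- inherits injectivity from `f ∘ g`.
  have hfg := OrzechProperty.injective_of_surjective_endomorphism (f.comp g) (hf.comp hg)
  intro x y hxy
  obtain ⟨x, rfl⟩ := hg x
  obtain ⟨y, rfl⟩ := hg y
  exact congrArg g (hfg hxy)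


section Model

variable {u₀ u₁ α β : Kˣ}

theorem modelGen_quadratic (hαβ : α * β = -(u₀ * u₁)) (i : ℕ) (hi : i < n) :
    modelGen n ((u₀ : K) + u₁) (α : K) β i * modelGen n ((u₀ : K) + u₁) (α : K) β i =
      ((u₀ : K) + u₁) • modelGen n ((u₀ : K) + u₁) (α : K) β i + (-((u₀ : K) * u₁)) • 1 := by
  rw [modelGen_mul_self _ _ _ hi, ← Units.val_mul, hαβ]
  simp

/-- The matrix representation of the Hecke algebra on the free module on permutations. -/
noncomputable def heckeModel (hαβ : α * β = -(u₀ * u₁)) : HeckeAlgebra n u₀ u₁ →ₐ[K]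
    Matrix (Equiv.Perm (Fin (n + 1))) (Equiv.Perm (Fin (n + 1))) K :=
  heckeLift u₀ u₁ (isBraidSystem_modelGen ((u₀ : K) + u₁) (α : K) β) (modelGen_quadratic hαβ)

theorem heckeModel_braidGen (hαβ : α * β = -(u₀ * u₁)) {i : ℕ} (hi : i < n) :
    heckeModel hαβ (toHeckeHom u₀ u₁ (braidGen n i)) = modelGen n ((u₀ : K) + u₁) (α : K) β i :=
  heckeLift_braidGen _ _ _ _ hi

theorem ascProd_congr {G : Type*} [Monoid G] {s s' : ℕ → G} {k : ℕ} (h : ∀ i < k, s i = s' i) :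
    ascProd s k = ascProd s' k := by
  induction k with
  | zero => rfl
  | succ k ih => rw [ascProd, ascProd, ih fun i hi => h i (by lia), h k (by lia)]

theorem fundamental_congr {G : Type*} [Monoid G] {s s' : ℕ → G} {k : ℕ}
    (h : ∀ i < k, s i = s' i) : fundamental s k = fundamental s' k := by
  induction k with
  | zero => rfl
  | succ k ih => rw [fundamental, fundamental, ih fun i hi => h i (by lia), ascProd_congr h]

theorem heckeModel_garside (hαβ : α * β = -(u₀ * u₁)) :
    heckeModel hαβ (toHecke u₀ u₁ (garside n)) =
      fundamental (modelGen n ((u₀ : K) + u₁) (α : K) β) n := by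
  rw [toHecke_garside, map_fundamental]
  exact fundamental_congr fun i hi => heckeModel_braidGen hαβ hi

/-- Already evaluation at the identity permutation is injective. It is onto, because adjacent
transpositions generate and `α`, `β` are units, and its source is spanned by no more elements than
the rank of its target. -/
theorem heckeModel_injective (hαβ : α * β = -(u₀ * u₁)) :
    Function.Injective (heckeModel (n := n) hαβ) := by
  let f : HeckeAlgebra n u₀ u₁ →ₗ[K] (Equiv.Perm (Fin (n + 1)) → K) :=
    (LinearMap.applyₗ (Pi.single 1 1)).comp
      ((Matrix.toLin' (R := K)).toLinearMap.comp (heckeModel hαβ).toLinearMap)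
  have hf : ∀ x, f x = (heckeModel hαβ x).mulVec (Pi.single 1 1) := fun x => rfl
  have hstable : ∀ i : Fin n, ∀ v ∈ LinearMap.range f,
      (heckeMatrix ((u₀ : K) + u₁) (α : K) β i.castSucc i.succ).mulVec v ∈ LinearMap.range f := by
    rintro i _ ⟨x, rfl⟩
    refine ⟨toHeckeHom u₀ u₁ (braidGen n i) * x, ?_⟩
    rw [hf, hf, map_mul, heckeModel_braidGen hαβ i.isLt, Matrix.mulVec_mulVec, modelGen,
      dif_pos i.isLt]
  have hunit : ∀ (c : Kˣ) (v : Equiv.Perm (Fin (n + 1)) → K),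
      (c : K) • v ∈ LinearMap.range f → v ∈ LinearMap.range f := fun c v hv => by
    simpa [smul_smul] using Submodule.smul_mem _ ((c⁻¹ : Kˣ) : K) hv
  have hsingle : ∀ w : Equiv.Perm (Fin (n + 1)), Pi.single w 1 ∈ LinearMap.range f := by
    intro w
    have hw : w ∈ Submonoid.closure
        (Set.range fun i : Fin n => Equiv.swap i.castSucc i.succ) := by
      rw [Equiv.Perm.mclosure_swap_castSucc_succ]; trivial
    induction hw using Submonoid.closure_induction_right with
    | one => exact ⟨1, by rw [hf, map_one, Matrix.one_mulVec]⟩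
    | mul_right w _ y hy ih =>
      obtain ⟨i, rfl⟩ := hy
      have h := hstable i _ ih
      rw [heckeMatrix_mulVec_single] at h
      split_ifs at h
      · exact hunit α _ h
      · exact hunit β _ ((Submodule.add_mem_iff_right _ (Submodule.smul_mem _ _ ih)).1 h)
  have hsurj : Function.Surjective f := by
    rw [← LinearMap.range_eq_top, eq_top_iff, ← (Pi.basisFun K _).span_eq, Submodule.span_le]
    rintro _ ⟨w, rfl⟩
    simpa using hsingle w
  obtain ⟨B, hB, hspan⟩ := hecke_exists_span_eq_top (n := n) u₀ u₁
  have hinj := injective_of_surjective_of_card_le B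
    (by simpa [Fintype.card_perm] using hB) hspan f hsurj
  intro x y hxy
  exact hinj (by rw [hf, hf, hxy])

end Model

/-! ### Reduction to a matrix of polynomials -/

section Polynomial

open Polynomial

/-- The polynomial `∏ (X ^ 2 - (-1) ^ i u₀ ^ i u₁ ^ j)` over `i + j = n (n + 1)`. -/
noncomputable def garsidePoly (n : ℕ) (u₀ u₁ : K) : K[X] :=
  ∏ p ∈ Finset.HasAntidiagonal.antidiagonal (n * (n + 1)),
    (X ^ 2 - C ((-1 : K) ^ p.1 * u₀ ^ p.1 * u₁ ^ p.2))

theorem garsidePoly_map {A : Type*} [CommRing A] (φ : K →+* A) (u₀ u₁ : K) :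
    (garsidePoly n u₀ u₁).map φ = garsidePoly n (φ u₀) (φ u₁) := by
  simp [garsidePoly, Polynomial.map_prod]

/-- The value of the polynomial at the fundamental element of the model with `α = 1`. -/
noncomputable def garsideMatrix (n : ℕ) (u₀ u₁ : K) :
    Matrix (Equiv.Perm (Fin (n + 1))) (Equiv.Perm (Fin (n + 1))) K :=
  aeval (fundamental (modelGen n (u₀ + u₁) 1 (-(u₀ * u₁))) n) (garsidePoly n u₀ u₁)

theorem garsideMatrix_map {A : Type*} [CommRing A] (φ : K →+* A) (u₀ u₁ : K) :
    φ.mapMatrix (garsideMatrix n u₀ u₁) = garsideMatrix n (φ u₀) (φ u₁) := by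
  have hcomp : φ.mapMatrix.comp (algebraMap K (Matrix (Equiv.Perm (Fin (n + 1)))
      (Equiv.Perm (Fin (n + 1))) K)) = (algebraMap A _).comp φ := by
    ext x i j
    by_cases hij : i = j <;> simp [Matrix.algebraMap_matrix_apply, hij]
  rw [garsideMatrix, aeval_def, hom_eval₂, hcomp, ← eval₂_map, garsidePoly_map, map_fundamental,
    garsideMatrix, aeval_def]
  simp only [modelGen_map, map_add, map_one, map_neg, map_mul]

theorem aeval_garside_eq_zero_iff (u₀ u₁ : Kˣ) :
    aeval (toHecke u₀ u₁ (garside n)) (garsidePoly n (u₀ : K) u₁) = 0 ↔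
      garsideMatrix n (u₀ : K) u₁ = 0 := by
  have hαβ : (1 : Kˣ) * (-(u₀ * u₁)) = -(u₀ * u₁) := one_mul _
  rw [← map_eq_zero_iff _ (heckeModel_injective (n := n) hαβ), ← aeval_algHom_apply,
    heckeModel_garside, garsideMatrix]
  simp

theorem garsidePoly_eq_expand (u₀ u₁ : K) : garsidePoly n u₀ u₁ =
    (∏ p ∈ Finset.HasAntidiagonal.antidiagonal (n * (n + 1)),
      (X - C (u₀ ^ p.1 * (-u₁) ^ p.2))).comp (X ^ 2) := by
  rw [garsidePoly, prod_comp]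
  refine Finset.prod_congr rfl fun p hp => ?_
  have hpar : (-1 : K) ^ p.1 = (-1) ^ p.2 := by
    have heven : Even (p.1 + p.2) := by
      rw [Finset.HasAntidiagonal.mem_antidiagonal.1 hp]; exact Nat.even_mul_succ_self n
    rw [Nat.even_add] at heven
    rcases Nat.even_or_odd p.1 with h | h
    · rw [h.neg_one_pow, (heven.1 h).neg_one_pow]
    · rw [h.neg_one_pow, Odd.neg_one_pow]
      rw [← Nat.not_even_iff_odd] at h ⊢
      exact fun h' => h (heven.2 h')
  rw [hpar, neg_pow u₁]
  simp only [sub_comp, X_comp, C_comp]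
  congr 2
  ring

end Polynomial

/-! ### Real parameters and specialisation -/

section Real

open Polynomial

theorem jucysMurphy_isHermitian (t α : ℝ) (k : ℕ) :
    (jucysMurphy (modelGen n t α α) k).IsHermitian := by
  induction k with
  | zero => exact Matrix.isHermitian_one
  | succ k ih =>
    have h := modelGen_transpose (n := n) t α k
    rw [Matrix.IsHermitian, Matrix.conjTranspose_eq_transpose_of_trivial] at *
    rw [jucysMurphy, Matrix.transpose_mul, Matrix.transpose_mul, ih, h, mul_assoc]

theorem map_jucysMurphy {G H F : Type*} [Monoid G] [Monoid H] [FunLike F G H]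
    [MonoidHomClass F G H] (f : F) (s : ℕ → G) (k : ℕ) :
    f (jucysMurphy s k) = jucysMurphy (fun i => f (s i)) k := by
  induction k with
  | zero => simp [jucysMurphy]
  | succ k ih => simp [jucysMurphy, ih]

/-- The identity holds for real parameters of opposite signs, where the Jucys–Murphy elements act
by symmetric matrices in a suitable model. -/
theorem aeval_fundamental_modelGen_eq_zero {x y : ℝ} (hx : x ≠ 0) (hy : y ≠ 0) :
    aeval (fundamental (modelGen n (x ^ 2 + -y ^ 2) (x * y) (x * y)) n)
      (garsidePoly n (x ^ 2) (-y ^ 2)) = 0 := by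
  let Φ := Matrix.toLpLinAlgEquiv (R := ℝ) (n := Equiv.Perm (Fin (n + 1))) 2
  let g := modelGen n (x ^ 2 + -y ^ 2) (x * y) (x * y)
  let s := fun i => Φ (g i)
  have hs : IsBraidSystem s n := (isBraidSystem_modelGen _ _ _).map Φ
  have hq : ∀ i < n, s i * s i = (x ^ 2 + -y ^ 2) • s i + (-(x ^ 2 * -y ^ 2)) • 1 := by
    intro i hi
    have h := congrArg Φ (modelGen_mul_self (n := n) (x ^ 2 + -y ^ 2) (x * y) (x * y) hi)
    rw [map_mul, map_add, map_smul, map_smul, map_one] at h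
    rw [h]
    congr 2
    ring
  have hsymm : ∀ k : Fin (n + 1), (jucysMurphy s k).IsSymmetric := fun k => by
    rw [← map_jucysMurphy]
    exact Matrix.isSymmetric_toEuclideanLin_iff.2 (jucysMurphy_isHermitian _ _ k)
  have hcomm : Pairwise (Function.onFun Commute fun k : Fin (n + 1) => jucysMurphy s k) :=
    fun j k _ => hs.commute_jucysMurphy_jucysMurphy (Nat.le_of_lt_succ j.isLt)
      (Nat.le_of_lt_succ k.isLt)
  have htop := LinearMap.IsSymmetric.iSup_iInf_eq_top_of_commute hsymm hcomm
  apply Φ.injective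
  rw [map_zero, ← aeval_algHom_apply, map_fundamental, garsidePoly_eq_expand, aeval_comp,
    aeval_X_pow, ← LinearMap.ker_eq_top, eq_top_iff, ← htop, iSup_le_iff]
  intro χ v hv
  rw [LinearMap.mem_ker]
  by_cases hv0 : v = 0
  · rw [hv0, map_zero]
  obtain ⟨a, b, hab, hev⟩ := hs.exists_fundamental_sq_eigenvalue (pow_ne_zero 2 hx)
    -- The default `0` is never read: only indices up to `n` occur.
    (neg_ne_zero.2 (pow_ne_zero 2 hy)) hq (χ := fun j => if h : j < n + 1 then χ ⟨j, h⟩ else 0)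
    hv0 le_rfl (fun j hj => by
      have hj' : j < n + 1 := Nat.lt_succ_of_le hj
      rw [dif_pos hj']
      exact Module.End.mem_eigenspace_iff.1 ((Submodule.mem_iInf _).1 hv ⟨j, hj'⟩))
  rw [Module.End.aeval_apply_of_hasEigenvector (Module.End.hasEigenvector_iff.2
    ⟨Module.End.mem_eigenspace_iff.2 hev, hv0⟩), eval_prod,
    Finset.prod_eq_zero (i := (a, b)) (Finset.HasAntidiagonal.mem_antidiagonal.2 hab) (by simp),
    zero_smul]

/-- The symmetric model and the model with `α = 1` are both faithful, so the identity passes from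
one to the other through the Hecke algebra. -/
theorem garsideMatrix_eq_zero_of_real {a b : ℝ} (ha : 0 < a) (hb : b < 0) :
    garsideMatrix n a b = 0 := by
  have hx : (√a) ≠ 0 := (Real.sqrt_pos.2 ha).ne'
  have hy : (√(-b)) ≠ 0 := (Real.sqrt_pos.2 (neg_pos.2 hb)).ne'
  have hx2 : √a ^ 2 = a := Real.sq_sqrt ha.le
  have hy2 : -√(-b) ^ 2 = b := by rw [Real.sq_sqrt (neg_pos.2 hb).le, neg_neg]
  have hzero := aeval_fundamental_modelGen_eq_zero (n := n) hx hy
  rw [hx2, hy2] at hzero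
  let u₀ : ℝˣ := Units.mk0 a ha.ne'
  let u₁ : ℝˣ := Units.mk0 b hb.ne
  let α : ℝˣ := Units.mk0 (√a * √(-b)) (mul_ne_zero hx hy)
  have hαβ : α * α = -(u₀ * u₁) := by
    ext
    change √a * √(-b) * (√a * √(-b)) = -(a * b)
    linear_combination √(-b) ^ 2 * hx2 - a * hy2
  refine (aeval_garside_eq_zero_iff u₀ u₁).1 (heckeModel_injective hαβ ?_)
  rw [map_zero, ← aeval_algHom_apply, heckeModel_garside]
  exact hzero

theorem garsideMatrix_generic_eq_zero : garsideMatrix n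
    (MvPolynomial.X 0 : MvPolynomial (Fin 2) ℤ) (MvPolynomial.X 1) = 0 := by
  refine Matrix.ext fun v w => ?_
  rw [Matrix.zero_apply]
  refine (MvPolynomial.map_injective (Int.castRingHom ℝ) Int.cast_injective) ?_
  rw [map_zero]
  -- A real polynomial vanishing on a product of infinite sets is zero.
  refine MvPolynomial.funext_set ![Set.Ioi 0, Set.Iio 0] ?_ fun x hx => ?_
  · intro i
    fin_cases i
    · exact Set.Ioi_infinite 0
    · exact Set.Iio_infinite 0
  have h := garsideMatrix_map (n := n)
    ((MvPolynomial.eval x).comp (MvPolynomial.map (Int.castRingHom ℝ)))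
    (MvPolynomial.X 0) (MvPolynomial.X 1)
  have h0 : 0 < x 0 := hx 0 trivial
  have h1 : x 1 < 0 := hx 1 trivial
  simp only [RingHom.comp_apply, MvPolynomial.map_X, MvPolynomial.eval_X] at h
  rw [garsideMatrix_eq_zero_of_real h0 h1] at h
  rw [map_zero]
  exact congrFun (congrFun h v) w

theorem garsideMatrix_eq_zero (u₀ u₁ : K) : garsideMatrix n u₀ u₁ = 0 := by
  have h := garsideMatrix_map (n := n) (MvPolynomial.aeval (R := ℤ) ![u₀, u₁]).toRingHom
    (MvPolynomial.X 0) (MvPolynomial.X 1)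
  rw [garsideMatrix_generic_eq_zero, map_zero] at h
  simpa using h.symm

end Real

end TypeA

theorem lemma2p11 {K : Type*} [CommRing K] (n : ℕ) (u₀ u₁ : Kˣ) :
    Polynomial.aeval (TypeA.toHecke u₀ u₁ (TypeA.garside n))
      (∏ p ∈ Finset.HasAntidiagonal.antidiagonal (n * (n + 1)),
        (Polynomial.X ^ 2 -
          Polynomial.C ((-1 : K) ^ p.1 * (u₀ : K) ^ p.1 * (u₁ : K) ^ p.2))) = 0 :=
  (TypeA.aeval_garside_eq_zero_iff u₀ u₁).2 (TypeA.garsideMatrix_eq_zero _ _)
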